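/- Let $q\ge 1$ and let $w=(w_1,\dots,w_q)$ be a parallel Laplacian source: the coordinates $w_i$ are independent, and $w_i$ has density $x\mapsto\frac{\lambda_i}{2}e^{-\lambda_i|x|}$ on $\mathbb{R}$, with $\lambda_i>0$. Let the distortion be $d(w,\hat w)=\|w-\hat w\|$ (Euclidean norm); all logarithms are to base $2$. For $D\ge 0$ let $R(D)=\inf I(w;\hat w)$, the infimum being over all conditional laws $P_{\hat w\mid w}$ with $\mathbb{E}\|w-\hat w\|\le D$; for $R\ge 0$ let $D(R)=\inf \mathbb{E}\|w-\hat w\|$, the infimum being over all conditional laws with $I(w;\hat w)\le R$. Call $(R,D)$ achievable if for every $n$ there are an encoder $e_n:(\mathbb{R}^q)^n\to\{1,\dots,M_n\}$ and a decoder $g_n:\{1,\dots,M_n\}\to(\mathbb{R}^q)^n$ with $M_n\le 2^{nR}$ such that, for i.i.d. copies $W^n=(w_1,\dots,w_n)$ of the source and $\hat W^n=g_n(e_n(W^n))$, one has $\limsup_{n\to\infty}\mathbb{E}\big[\frac1n\sum_{k=1}^n\|w_k-\hat w_k\|\big]\le D$. Let $R_{\rm op}(D)=\inf\{R\ge 0:(R,D)\text{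 achievable}\}$ and $D_{\rm op}(R)=\inf\{D\ge 0:(R,D)\text{ achievable}\}$. (a) For every $D\ge0$ and every $\mu\ge 0$ with $$\sum_{i:\,\mu<1/\lambda_i}\frac{\mu}{\sqrt q}+\sum_{i:\,\mu\ge 1/\lambda_i}\frac{1}{\lambda_i\sqrt q}=D ,$$ both $R(D)$ and $R_{\rm op}(D)$ are at least $$\sum_{i=1}^q\max\{-\log(\lambda_i\mu),\,0\},$$ where $-\log 0=+\infty$. Such a $\mu$ exists whenever $0\le D\le\sum_{i=1}^q\frac{1}{\lambda_i\sqrt q}$. (b) For every $R\ge 0$ and every $\mu>0$ with $\sum_{i:\,\mu<1/\lambda_i}-\log(\lambda_i\mu)=R$, both $D(R)$ and $D_{\rm op}(R)$ are at least $$\sum_{i=1}^q\min\Big\{\frac{\mu}{\sqrt q},\,\frac{1}{\lambda_i\sqrt q}\Big\}.$$ Such a $\mu$ exists for every $R\ge 0$. -/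

import Mathlib

open MeasureTheory ProbabilityTheory Filter
open scoped ENNReal NNReal

noncomputable section

/-- The zero-mean Laplace law on `ℝ` in the parametrization with density
`x ↦ (l / 2) * exp (-l * |x|)`. -/
def laplaceLaw (l : ℝ) : Measure ℝ :=
  volume.withDensity fun x => ENNReal.ofReal (l / 2 * Real.exp (-(l * |x|)))

/-- The parallel Laplacian source: the law on Euclidean `ℝ^q` of a vector whose coordinates are
independent, the `i`-th one being zero-mean Laplacian with parameter `lam i`. -/
def parallelLaplaceLaw {q : ℕ} (lam : Fin q → ℝ) : Measure (EuclideanSpace ℝ (Fin q)) :=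
  (Measure.pi fun i => laplaceLaw (lam i)).map (WithLp.toLp 2)

section General

variable {E : Type*} [MeasurableSpace E]

/-- Mutual information `I(w ; ŵ)`, in bits, when `w` has law `P` and the conditional law of `ŵ`
given `w` is `κ`: the Kullback-Leibler divergence from the product of the two marginals to the
joint law. -/
def mutualInfoBits (P : Measure E) (κ : Kernel E E) : ℝ≥0∞ :=
  InformationTheory.klDiv (P ⊗ₘ κ) (P.prod (κ ∘ₘ P)) / ENNReal.ofReal (Real.log 2)

variable [NormedAddCommGroup E]

/-- Expected distortion `𝔼 ‖w - ŵ‖` when `w` has law `P` and `ŵ` has conditional law `κ`. -/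
def expectedDistortion (P : Measure E) (κ : Kernel E E) : ℝ≥0∞ :=
  ∫⁻ w, ∫⁻ v, ‖w - v‖ₑ ∂(κ w) ∂P

/-- The rate-distortion function: the infimum of the mutual information over all conditional laws
`P_{ŵ|w}` with `𝔼 ‖w - ŵ‖ ≤ D`. -/
def rateDistortion (P : Measure E) (D : ℝ) : ℝ≥0∞ :=
  ⨅ (κ : Kernel E E) (_ : IsMarkovKernel κ)
    (_ : expectedDistortion P κ ≤ ENNReal.ofReal D), mutualInfoBits P κ

/-- The distortion-rate function: the infimum of `𝔼 ‖w - ŵ‖` over all conditional laws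
`P_{ŵ|w}` with `I(w ; ŵ) ≤ R`. -/
def distortionRate (P : Measure E) (R : ℝ) : ℝ≥0∞ :=
  ⨅ (κ : Kernel E E) (_ : IsMarkovKernel κ)
    (_ : mutualInfoBits P κ ≤ ENNReal.ofReal R), expectedDistortion P κ

/-- The distortion between two blocks of length `n`: the average of the letterwise distortions. -/
def blockDistortion {n : ℕ} (x y : Fin n → E) : ℝ≥0∞ :=
  (∑ k, ‖x k - y k‖ₑ) / (n : ℝ≥0∞)

/-- The pair `(R, D)` is achievable for the i.i.d. source with letter law `P`: there are encoders
`e n` and decoders `g n` for blocks of length `n`, with at most `2 ^ (n R)` code-words, whose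
expected distortion is asymptotically at most `D`. -/
def IsAchievable (P : Measure E) (R D : ℝ) : Prop :=
  ∃ (M : ℕ → ℕ) (e : ∀ n, (Fin n → E) → Fin (M n)) (g : ∀ n, Fin (M n) → (Fin n → E)),
    (∀ n, Measurable (e n)) ∧
    (∀ n, (M n : ℝ) ≤ (2 : ℝ) ^ ((n : ℝ) * R)) ∧
    limsup (fun n => ∫⁻ x, blockDistortion x (g n (e n x)) ∂(Measure.pi fun _ : Fin n => P)) atTop
      ≤ ENNReal.ofReal D

/-- Operational rate-distortion function: the infimum of the rates `R` such that `(R, D)` is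
achievable (`∞` if there is none). -/
def operationalRateDistortion (P : Measure E) (D : ℝ) : ℝ≥0∞ :=
  ⨅ (R : ℝ≥0) (_ : IsAchievable P R D), (R : ℝ≥0∞)

/-- Operational distortion-rate function: the infimum of the distortions `D` such that `(R, D)` is
achievable. -/
def operationalDistortionRate (P : Measure E) (R : ℝ) : ℝ≥0∞ :=
  ⨅ (D : ℝ≥0) (_ : IsAchievable P R D), (D : ℝ≥0∞)

end General

/-- `max {-log₂ x, 0}` for `x ≥ 0`, with the convention `-log₂ 0 = ∞`. -/
def negLogPos (x : ℝ) : ℝ≥0∞ :=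
  if x ≤ 0 then ⊤ else ENNReal.ofReal (max (-Real.logb 2 x) 0)

/-- The water level `μ` solves the reverse water-filling equation for the distortion `D`. -/
def IsWaterLevelForDistortion {q : ℕ} (lam : Fin q → ℝ) (D μ : ℝ) : Prop :=
  (∑ i with μ < 1 / lam i, μ / √(q : ℝ)) + (∑ i with 1 / lam i ≤ μ, 1 / (lam i * √(q : ℝ))) = D

/-- The water level `μ` solves the reverse water-filling equation for the rate `R`. -/
def IsWaterLevelForRate {q : ℕ} (lam : Fin q → ℝ) (R μ : ℝ) : Prop :=
  (∑ i with μ < 1 / lam i, -Real.logb 2 (lam i * μ)) = R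

end

/-!
Everything rests on one family of supporting lines. For a slope `s > 0` consider the test function
`f w v = ∑ i, (log⁺ (s / lam i) + min (lam i) s * |w i|) - s * √q * ‖w - v‖`.
By Cauchy-Schwarz `√q * ‖w - v‖` dominates the `ℓ¹` distance, so `exp (f · v)` is at most a
product over the coordinates, and its integral against the source law is at most `1` for every
reproduction `v` (`lintegral_exp_parallelLaplaceLaw_le_one`). A coordinate with `lam i < s` contributes the integral
of a Laplace density with parameter `s` centred at `v i`; a coordinate with `s ≤ lam i` is controlled
by weighted AM-GM (`lintegral_exp_laplaceLaw_le_one`).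

Such a test function bounds information in two ways. For a test channel, the Donsker-Varadhan
inequality `lintegral_le_klDiv_add_lintegral` bounds the mean of `f` under the joint law by the mutual
information. For a block code with `M` code-words, `lintegral_le_log_add_lintegral_code` bounds the
mean of the `n`-letter sum of `f` by `log M`, since an exponential moment along the code is at most
the sum of those over the individual code-words; hence the operational bounds need neither a
converse coding theorem nor the convexity of the rate-distortion function. Both give, for all `s > 0`,
`meanPotential lam s ≤ R * log 2 + s * √q * D`,
where `meanPotential` is the mean of the part of `f` that depends on `w` alone.

At `s = 1 / μ` the left side is `log 2` times the water-filling rate plus `s * √q` times the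
water-filling distortion (`meanPotential_one_div`), so fixing one of the two coordinates at its
water-filling value bounds the other. The level `μ = 0` is reached through arbitrarily large slopes.
The levels themselves exist by the intermediate value theorem.
-/

noncomputable section

/-! ### The Laplace law -/

lemma measurable_laplace_density (l : ℝ) :
    Measurable fun x : ℝ => ENNReal.ofReal (l / 2 * Real.exp (-(l * |x|))) := by
  fun_prop

lemma integral_laplace_density {l : ℝ} (hl : 0 < l) :
    ∫ x : ℝ, l / 2 * Real.exp (-(l * |x|)) = 1 := by
  rw [integral_comp_abs (f := fun x : ℝ => l / 2 * Real.exp (-(l * x)))]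
  have h := Real.integral_rpow_mul_exp_neg_mul_Ioi (a := 1) one_pos hl
  simp only [sub_self, Real.rpow_zero, one_mul, Real.rpow_one, Real.Gamma_one, mul_one] at h
  rw [integral_const_mul, h]
  field_simp

lemma integral_abs_mul_laplace_density {l : ℝ} (hl : 0 < l) :
    ∫ x : ℝ, l / 2 * Real.exp (-(l * |x|)) * |x| = 1 / l := by
  rw [integral_comp_abs (f := fun x : ℝ => l / 2 * Real.exp (-(l * x)) * x)]
  have h := Real.integral_rpow_mul_exp_neg_mul_Ioi (a := 2) two_pos hl
  norm_num [Real.Gamma_two] at h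
  have h2 : ∀ x : ℝ, l / 2 * Real.exp (-(l * x)) * x = l / 2 * (x * Real.exp (-(l * x))) :=
    fun x => by ring
  simp only [h2]
  rw [integral_const_mul, h]
  field_simp

lemma lintegral_laplace_density {l : ℝ} (hl : 0 < l) :
    ∫⁻ x : ℝ, ENNReal.ofReal (l / 2 * Real.exp (-(l * |x|))) = 1 := by
  have h := integral_laplace_density hl
  rw [← ofReal_integral_eq_lintegral_ofReal, h, ENNReal.ofReal_one]
  -- A function with nonzero Bochner integral is integrable.
  · exact not_imp_comm.1 integral_undef (by rw [h]; exact one_ne_zero)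
  · exact ae_of_all _ fun x => by positivity

lemma lintegral_laplace_density_sub {l : ℝ} (hl : 0 < l) (v : ℝ) :
    ∫⁻ x : ℝ, ENNReal.ofReal (l / 2 * Real.exp (-(l * |x - v|))) = 1 := by
  rw [lintegral_sub_right_eq_self
    (fun x : ℝ => ENNReal.ofReal (l / 2 * Real.exp (-(l * |x|)))) v]
  exact lintegral_laplace_density hl

lemma isProbabilityMeasure_laplaceLaw {l : ℝ} (hl : 0 < l) :
    IsProbabilityMeasure (laplaceLaw l) := by
  refine ⟨?_⟩
  rw [laplaceLaw, withDensity_apply _ MeasurableSet.univ, Measure.restrict_univ]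
  exact lintegral_laplace_density hl

lemma lintegral_abs_laplaceLaw {l : ℝ} (hl : 0 < l) :
    ∫⁻ x, ENNReal.ofReal |x| ∂laplaceLaw l = ENNReal.ofReal (1 / l) := by
  have h := integral_abs_mul_laplace_density hl
  rw [laplaceLaw, lintegral_withDensity_eq_lintegral_mul _ (measurable_laplace_density l)
    (by fun_prop)]
  simp only [Pi.mul_apply]
  rw [← h, ofReal_integral_eq_lintegral_ofReal]
  · refine lintegral_congr fun x => ?_
    rw [← ENNReal.ofReal_mul (by positivity)]
  · exact not_imp_comm.1 integral_undef (by rw [h]; positivity)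
  · exact ae_of_all _ fun x => by positivity

/-- The exponential moment behind the Shannon lower bound for one Laplacian coordinate. If
`l < s` the tilted density is the Laplace density with parameter `s` centred at `v`; otherwise
weighted AM-GM dominates it by a mixture of Laplace densities with parameter `l`. -/
lemma lintegral_exp_laplaceLaw_le_one {l s : ℝ} (hl : 0 < l) (hs : 0 < s) (v : ℝ) :
    ∫⁻ x, ENNReal.ofReal
      (Real.exp (max (Real.log (s / l)) 0 + min l s * |x| - s * |x - v|)) ∂laplaceLaw l ≤ 1 := by
  rw [laplaceLaw, lintegral_withDensity_eq_lintegral_mul _ (measurable_laplace_density l)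
    (by fun_prop)]
  simp only [Pi.mul_apply]
  rcases lt_or_ge l s with h | h
  · rw [max_eq_left (Real.log_nonneg (by rw [le_div_iff₀ hl]; linarith)), min_eq_left h.le]
    refine le_of_eq ?_
    rw [← lintegral_laplace_density_sub hs v]
    refine lintegral_congr fun x => ?_
    rw [← ENNReal.ofReal_mul (by positivity)]
    congr 1
    have h2 : Real.exp (Real.log (s / l) + l * |x| - s * |x - v|)
        = s / l * (Real.exp (l * |x|) * Real.exp (-(s * |x - v|))) := by
      rw [← Real.exp_add, add_sub_assoc, Real.exp_add, Real.exp_log (by positivity)]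
      rfl
    have h3 : Real.exp (-(l * |x|)) * Real.exp (l * |x|) = 1 := by
      rw [← Real.exp_add]; simp
    rw [h2]
    calc _ = (Real.exp (-(l * |x|)) * Real.exp (l * |x|)) *
          (l / 2 * (s / l) * Real.exp (-(s * |x - v|))) := by ring
      _ = _ := by rw [h3]; field_simp
  · rw [max_eq_right (Real.log_nonpos (by positivity) (by rw [div_le_one hl]; exact h)),
      min_eq_right h]
    have hc : (l - s) / l + s / l = 1 := by field_simp; ring
    have h0 : 0 ≤ (l - s) / l := div_nonneg (by linarith) hl.le
    have h1 : 0 ≤ s / l := by positivity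
    calc _ ≤ ∫⁻ x : ℝ, (ENNReal.ofReal ((l - s) / l) *
            ENNReal.ofReal (l / 2 * Real.exp (-(l * |x|))) + ENNReal.ofReal (s / l) *
            ENNReal.ofReal (l / 2 * Real.exp (-(l * |x - v|)))) := by
          refine lintegral_mono fun x => ?_
          rw [← ENNReal.ofReal_mul (by positivity), ← ENNReal.ofReal_mul h0,
            ← ENNReal.ofReal_mul h1, ← ENNReal.ofReal_add (by positivity) (by positivity)]
          refine ENNReal.ofReal_le_ofReal ?_
          have hconv := convexOn_exp.2 (Set.mem_univ (-(l * |x|)))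
            (Set.mem_univ (-(l * |x - v|))) h0 h1 hc
          simp only [smul_eq_mul] at hconv
          have he : (l - s) / l * (-(l * |x|)) + s / l * (-(l * |x - v|))
              = -(l * |x|) + (0 + s * |x| - s * |x - v|) := by
            field_simp; ring
          rw [he, Real.exp_add] at hconv
          nlinarith [mul_le_mul_of_nonneg_left hconv (by positivity : 0 ≤ l / 2)]
      _ = 1 := by
          rw [lintegral_add_left (by fun_prop), lintegral_const_mul _ (by fun_prop),
            lintegral_const_mul _ (by fun_prop), lintegral_laplace_density hl,
            lintegral_laplace_density_sub hl, mul_one, mul_one, ← ENNReal.ofReal_add h0 h1, hc,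
            ENNReal.ofReal_one]

/-! ### Integrals of products over product measures -/

lemma lintegral_pi_prod {ι : Type*} [Fintype ι] {Ω : ι → Type*} [∀ i, MeasurableSpace (Ω i)]
    (P : ∀ i, Measure (Ω i)) [∀ i, IsProbabilityMeasure (P i)] {f : ∀ i, Ω i → ℝ≥0∞}
    (hf : ∀ i, Measurable (f i)) :
    ∫⁻ x, ∏ i, f i (x i) ∂Measure.pi P = ∏ i, ∫⁻ y, f i y ∂P i := by
  have hind := iIndepFun_pi (μ := P) (X := f) fun i => (hf i).aemeasurable
  have h := lintegral_prod_eq_prod_lintegral_of_indepFun Finset.univ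
    (fun (i : ι) (x : ∀ i, Ω i) => f i (x i)) hind
    (fun i => (hf i).comp (measurable_pi_apply i))
  rw [h]
  refine Finset.prod_congr rfl fun i _ => ?_
  exact (measurePreserving_eval P i).lintegral_comp (hf i)

/-! ### Dual lower bounds on information and on codebook size -/

/-- Young's inequality for the conjugate pair `InformationTheory.klFun` and `t ↦ exp t - 1`. -/
lemma mul_add_one_le_klFun_add_exp {g : ℝ} (hg : 0 ≤ g) (t : ℝ) :
    g * t + 1 ≤ InformationTheory.klFun g + Real.exp t := by
  rw [InformationTheory.klFun_apply]
  rcases hg.eq_or_lt with rfl | hg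
  · simpa using (Real.exp_pos t).le
  · have h := Real.add_one_le_exp (t - Real.log g)
    rw [Real.exp_sub, Real.exp_log hg, le_div_iff₀ hg] at h
    linarith

/-- The Donsker-Varadhan inequality `∫ (a - b) dμ ≤ KL(μ ‖ ν)` when `∫ exp (a - b) dν ≤ 1`,
arranged so that neither `a` nor `b` has to be integrable. -/
lemma lintegral_le_klDiv_add_lintegral {α : Type*} [MeasurableSpace α] (μ ν : Measure α)
    [IsFiniteMeasure μ] [IsProbabilityMeasure ν] {a b : α → ℝ} (ha : Measurable a)
    (hb : Measurable b) (ha0 : ∀ x, 0 ≤ a x) (hb0 : ∀ x, 0 ≤ b x)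
    (hab : ∫⁻ x, ENNReal.ofReal (Real.exp (a x - b x)) ∂ν ≤ 1) :
    ∫⁻ x, ENNReal.ofReal (a x) ∂μ ≤
      InformationTheory.klDiv μ ν + ∫⁻ x, ENNReal.ofReal (b x) ∂μ := by
  by_cases hac : μ ≪ ν
  swap
  · simp [InformationTheory.klDiv_of_not_ac hac]
  rw [InformationTheory.klDiv_eq_lintegral_klFun_of_ac hac,
    ← lintegral_rnDeriv_mul hac (f := fun x => ENNReal.ofReal (a x)) (by fun_prop),
    ← lintegral_rnDeriv_mul hac (f := fun x => ENNReal.ofReal (b x)) (by fun_prop)]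
  have hg : Measurable (μ.rnDeriv ν) := Measure.measurable_rnDeriv μ ν
  have hk : Measurable fun x => ENNReal.ofReal
      (InformationTheory.klFun (μ.rnDeriv ν x).toReal) := by
    have := InformationTheory.measurable_klFun
    fun_prop
  refine (ENNReal.add_le_add_iff_right ENNReal.one_ne_top).1 ?_
  calc (∫⁻ x, μ.rnDeriv ν x * ENNReal.ofReal (a x) ∂ν) + 1
      = ∫⁻ x, (μ.rnDeriv ν x * ENNReal.ofReal (a x) + 1) ∂ν := by
        rw [lintegral_add_right _ measurable_const, lintegral_one, measure_univ]
    _ ≤ ∫⁻ x, (ENNReal.ofReal (InformationTheory.klFun (μ.rnDeriv ν x).toReal)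
          + μ.rnDeriv ν x * ENNReal.ofReal (b x) + ENNReal.ofReal (Real.exp (a x - b x))) ∂ν := by
        refine lintegral_mono_ae ?_
        filter_upwards [Measure.rnDeriv_lt_top μ ν] with x hx
        have hg0 : 0 ≤ (μ.rnDeriv ν x).toReal := ENNReal.toReal_nonneg
        rw [← ENNReal.ofReal_toReal hx.ne, ENNReal.toReal_ofReal hg0, ← ENNReal.ofReal_mul hg0,
          ← ENNReal.ofReal_mul hg0, ← ENNReal.ofReal_one,
          ← ENNReal.ofReal_add (mul_nonneg hg0 (ha0 x)) zero_le_one,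
          ← ENNReal.ofReal_add (InformationTheory.klFun_nonneg hg0) (mul_nonneg hg0 (hb0 x)),
          ← ENNReal.ofReal_add (add_nonneg (InformationTheory.klFun_nonneg hg0)
            (mul_nonneg hg0 (hb0 x))) (Real.exp_pos _).le]
        refine ENNReal.ofReal_le_ofReal ?_
        linarith [mul_add_one_le_klFun_add_exp hg0 (a x - b x)]
    _ ≤ _ := by
        rw [lintegral_add_right _ (by fun_prop), lintegral_add_left hk]
        gcongr

/-- The analogue for codes of the Donsker-Varadhan inequality, with `log M` in place of the
divergence. The exponential moment of `a - b` along the code is at most the sum of the `M`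
exponential moments for constant code-words. -/
lemma lintegral_le_log_add_lintegral_code {Ω : Type*} [MeasurableSpace Ω] (P : Measure Ω)
    [IsProbabilityMeasure P] {M : ℕ} {e : Ω → Fin M} (he : Measurable e) {a : Ω → ℝ}
    {b : Fin M → Ω → ℝ} (ha : Measurable a) (hb : ∀ m, Measurable (b m)) (ha0 : ∀ x, 0 ≤ a x)
    (hb0 : ∀ m x, 0 ≤ b m x)
    (hab : ∀ m, ∫⁻ x, ENNReal.ofReal (Real.exp (a x - b m x)) ∂P ≤ 1) :
    ∫⁻ x, ENNReal.ofReal (a x) ∂P ≤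
      ENNReal.ofReal (Real.log M) + ∫⁻ x, ENNReal.ofReal (b (e x) x) ∂P := by
  obtain ⟨x₀⟩ : Nonempty Ω := P.nonempty_of_neZero
  have hM : 0 < M := (e x₀).pos
  have hM' : (0 : ℝ) < M := by exact_mod_cast hM
  have hlog : 0 ≤ Real.log M := Real.log_natCast_nonneg M
  have hbe : Measurable fun x => b (e x) x :=
    (measurable_from_prod_countable_right (f := fun p : Fin M × Ω => b p.1 p.2) hb).comp
      (he.prodMk measurable_id)
  have hexpm : Measurable fun x => ENNReal.ofReal
      (Real.exp (a x - b (e x) x - Real.log M)) :=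
    ((ha.sub hbe).sub_const _).exp.ennreal_ofReal
  have hexp : ∫⁻ x, ENNReal.ofReal (Real.exp (a x - b (e x) x - Real.log M)) ∂P ≤ 1 := by
    calc ∫⁻ x, ENNReal.ofReal (Real.exp (a x - b (e x) x - Real.log M)) ∂P
        ≤ ∫⁻ x, ENNReal.ofReal (1 / M) *
            ∑ m, ENNReal.ofReal (Real.exp (a x - b m x)) ∂P := by
          refine lintegral_mono fun x => ?_
          have h1 : Real.exp (a x - b (e x) x - Real.log M)
              = 1 / M * Real.exp (a x - b (e x) x) := by
            rw [Real.exp_sub _ (Real.log M), Real.exp_log hM']; ring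
          rw [h1, ENNReal.ofReal_mul (by positivity)]
          gcongr
          exact Finset.single_le_sum
            (f := fun m => ENNReal.ofReal (Real.exp (a x - b m x))) (fun _ _ => zero_le)
            (Finset.mem_univ (e x))
      _ = ENNReal.ofReal (1 / M) *
            ∑ m, ∫⁻ x, ENNReal.ofReal (Real.exp (a x - b m x)) ∂P := by
          rw [lintegral_const_mul _ (by fun_prop), lintegral_finsetSum _ (by fun_prop)]
      _ ≤ ENNReal.ofReal (1 / M) * ∑ _m : Fin M, 1 := by
          gcongr with m
          exact hab m
      _ = 1 := by
          rw [Finset.sum_const, Finset.card_univ, Fintype.card_fin, nsmul_eq_mul, mul_one,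
            ← ENNReal.ofReal_natCast, ← ENNReal.ofReal_mul (by positivity),
            one_div_mul_cancel hM'.ne', ENNReal.ofReal_one]
  refine (ENNReal.add_le_add_iff_right ENNReal.one_ne_top).1 ?_
  calc (∫⁻ x, ENNReal.ofReal (a x) ∂P) + 1
      = ∫⁻ x, (ENNReal.ofReal (a x) + 1) ∂P := by
        rw [lintegral_add_right _ measurable_const, lintegral_one, measure_univ]
    _ ≤ ∫⁻ x, (ENNReal.ofReal (Real.log M) + ENNReal.ofReal (b (e x) x)
          + ENNReal.ofReal (Real.exp (a x - b (e x) x - Real.log M))) ∂P := by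
        refine lintegral_mono fun x => ?_
        rw [← ENNReal.ofReal_one, ← ENNReal.ofReal_add (ha0 x) zero_le_one,
          ← ENNReal.ofReal_add hlog (hb0 _ x),
          ← ENNReal.ofReal_add (add_nonneg hlog (hb0 _ x)) (Real.exp_pos _).le]
        refine ENNReal.ofReal_le_ofReal ?_
        linarith [Real.add_one_le_exp (a x - b (e x) x - Real.log M)]
    _ ≤ _ := by
        rw [lintegral_add_right _ hexpm,
          lintegral_add_right _ hbe.ennreal_ofReal, lintegral_const, measure_univ, mul_one]
        gcongr

/-! ### The dual certificate for the parallel Laplacian source -/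

section Certificate

variable {q : ℕ}

/-- The part of the test function that depends on the source letter only, for the slope `s`
(the inverse of the water level). The test function is
`sourcePotential lam s w - s * √q * ‖w - v‖`. -/
def sourcePotential (lam : Fin q → ℝ) (s : ℝ) (w : EuclideanSpace ℝ (Fin q)) : ℝ :=
  ∑ i, (max (Real.log (s / lam i)) 0 + min (lam i) s * |w i|)

/-- The mean of `sourcePotential lam s` under the parallel Laplacian law. -/
def meanPotential (lam : Fin q → ℝ) (s : ℝ) : ℝ :=
  ∑ i, (max (Real.log (s / lam i)) 0 + min (lam i) s * (1 / lam i))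

variable {lam : Fin q → ℝ}

lemma isProbabilityMeasure_parallelLaplaceLaw (hlam : ∀ i, 0 < lam i) :
    IsProbabilityMeasure (parallelLaplaceLaw lam) := by
  have := fun i => isProbabilityMeasure_laplaceLaw (hlam i)
  exact Measure.isProbabilityMeasure_map (by fun_prop)

@[fun_prop]
lemma measurable_sourcePotential (s : ℝ) : Measurable (sourcePotential lam s) := by
  unfold sourcePotential
  fun_prop

lemma sourcePotential_nonneg (hlam : ∀ i, 0 < lam i) {s : ℝ} (hs : 0 < s)
    (w : EuclideanSpace ℝ (Fin q)) : 0 ≤ sourcePotential lam s w :=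
  Finset.sum_nonneg fun i _ => add_nonneg (le_max_right _ _)
    (mul_nonneg (le_min (hlam i).le hs.le) (abs_nonneg _))

lemma lintegral_sourcePotential (hlam : ∀ i, 0 < lam i) {s : ℝ} (hs : 0 < s) :
    ∫⁻ w, ENNReal.ofReal (sourcePotential lam s w) ∂parallelLaplaceLaw lam =
      ENNReal.ofReal (meanPotential lam s) := by
  have := fun i => isProbabilityMeasure_laplaceLaw (hlam i)
  have hc : ∀ i, 0 ≤ min (lam i) s := fun i => le_min (hlam i).le hs.le
  have hm : ∀ i, 0 ≤ max (Real.log (s / lam i)) 0 := fun i => le_max_right _ _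
  rw [parallelLaplaceLaw, lintegral_map (by fun_prop) (by fun_prop)]
  simp only [sourcePotential, meanPotential]
  have hpt : ∀ x : Fin q → ℝ, ENNReal.ofReal
      (∑ i, (max (Real.log (s / lam i)) 0 + min (lam i) s * |x i|)) =
      ∑ i, (ENNReal.ofReal (max (Real.log (s / lam i)) 0)
        + ENNReal.ofReal (min (lam i) s) * ENNReal.ofReal |x i|) := fun x => by
    rw [ENNReal.ofReal_sum_of_nonneg
      fun i _ => add_nonneg (hm i) (mul_nonneg (hc i) (abs_nonneg _))]
    refine Finset.sum_congr rfl fun i _ => ?_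
    rw [ENNReal.ofReal_add (hm i) (mul_nonneg (hc i) (abs_nonneg _)), ENNReal.ofReal_mul (hc i)]
  simp only [hpt]
  rw [lintegral_finsetSum _ (by fun_prop), ENNReal.ofReal_sum_of_nonneg
    fun i _ => add_nonneg (hm i) (mul_nonneg (hc i) (one_div_pos.2 (hlam i)).le)]
  refine Finset.sum_congr rfl fun i _ => ?_
  rw [lintegral_add_left measurable_const, lintegral_const, measure_univ, mul_one,
    lintegral_const_mul _ (by fun_prop),
    (measurePreserving_eval (fun i => laplaceLaw (lam i)) i).lintegral_comp
      (f := fun y => ENNReal.ofReal |y|) (by fun_prop), lintegral_abs_laplaceLaw (hlam i),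
    ENNReal.ofReal_add (hm i) (mul_nonneg (hc i) (one_div_pos.2 (hlam i)).le),
    ENNReal.ofReal_mul (hc i)]

lemma sum_abs_le_sqrt_mul_norm (x : EuclideanSpace ℝ (Fin q)) :
    ∑ i, |x i| ≤ √(q : ℝ) * ‖x‖ := by
  rw [EuclideanSpace.norm_eq, ← Real.sqrt_mul (Nat.cast_nonneg q)]
  refine Real.le_sqrt_of_sq_le ?_
  simpa using sq_sum_le_card_mul_sum_sq (s := Finset.univ) (f := fun i => |x i|)

lemma lintegral_exp_parallelLaplaceLaw_le_one (hlam : ∀ i, 0 < lam i) {s : ℝ} (hs : 0 < s)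
    (v : EuclideanSpace ℝ (Fin q)) :
    ∫⁻ w, ENNReal.ofReal (Real.exp (sourcePotential lam s w - s * √(q : ℝ) * ‖w - v‖))
      ∂parallelLaplaceLaw lam ≤ 1 := by
  have := fun i => isProbabilityMeasure_laplaceLaw (hlam i)
  rw [parallelLaplaceLaw, lintegral_map (by fun_prop) (by fun_prop)]
  calc _ ≤ ∫⁻ x : Fin q → ℝ, ∏ i, ENNReal.ofReal (Real.exp (max (Real.log (s / lam i)) 0
            + min (lam i) s * |x i| - s * |x i - v i|))
            ∂Measure.pi fun i => laplaceLaw (lam i) := by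
        refine lintegral_mono fun x => ?_
        rw [← ENNReal.ofReal_prod_of_nonneg fun i _ => (Real.exp_pos _).le, ← Real.exp_sum]
        refine ENNReal.ofReal_le_ofReal (Real.exp_le_exp.2 ?_)
        rw [Finset.sum_sub_distrib, ← Finset.mul_sum, mul_assoc]
        have h := sum_abs_le_sqrt_mul_norm (WithLp.toLp 2 x - v)
        simp only [PiLp.sub_apply] at h
        exact sub_le_sub_left (mul_le_mul_of_nonneg_left h hs.le) _
    _ = ∏ i, ∫⁻ y, ENNReal.ofReal (Real.exp (max (Real.log (s / lam i)) 0
            + min (lam i) s * |y| - s * |y - v i|)) ∂laplaceLaw (lam i) :=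
        lintegral_pi_prod (fun i => laplaceLaw (lam i))
          (f := fun i y => ENNReal.ofReal (Real.exp (max (Real.log (s / lam i)) 0
            + min (lam i) s * |y| - s * |y - v i|))) fun i => by fun_prop
    _ ≤ 1 := Finset.prod_le_one' fun i _ => lintegral_exp_laplaceLaw_le_one (hlam i) hs (v i)

lemma ofReal_slope_mul_norm {s : ℝ} (hs : 0 < s) (x : EuclideanSpace ℝ (Fin q)) :
    ENNReal.ofReal (s * √(q : ℝ) * ‖x‖) = ENNReal.ofReal (s * √(q : ℝ)) * ‖x‖ₑ := by
  rw [ENNReal.ofReal_mul (by positivity), ofReal_norm]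

/-- The supporting line of slope `s` bounds the information of every test channel. -/
lemma ofReal_meanPotential_le_mutualInfoBits (hlam : ∀ i, 0 < lam i) {s : ℝ} (hs : 0 < s)
    (κ : Kernel (EuclideanSpace ℝ (Fin q)) (EuclideanSpace ℝ (Fin q))) [IsMarkovKernel κ] :
    ENNReal.ofReal (meanPotential lam s) ≤
      mutualInfoBits (parallelLaplaceLaw lam) κ * ENNReal.ofReal (Real.log 2) +
        ENNReal.ofReal (s * √(q : ℝ)) * expectedDistortion (parallelLaplaceLaw lam) κ := by
  have := isProbabilityMeasure_parallelLaplaceLaw hlam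
  have hlog : ENNReal.ofReal (Real.log 2) ≠ 0 := by
    simpa using Real.log_pos one_lt_two
  rw [mutualInfoBits, ENNReal.div_mul_cancel hlog ENNReal.ofReal_ne_top]
  set P := parallelLaplaceLaw lam
  have h := lintegral_le_klDiv_add_lintegral (P ⊗ₘ κ) (P.prod (κ ∘ₘ P))
    (a := fun p => sourcePotential lam s p.1) (b := fun p => s * √(q : ℝ) * ‖p.1 - p.2‖)
    (by fun_prop) (by fun_prop) (fun p => sourcePotential_nonneg hlam hs p.1)
    (fun p => by positivity) (by
      rw [lintegral_prod_symm' _ (by fun_prop)]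
      calc _ ≤ ∫⁻ _v, 1 ∂(κ ∘ₘ P) :=
            lintegral_mono fun v => lintegral_exp_parallelLaplaceLaw_le_one hlam hs v
        _ = 1 := by rw [lintegral_one, measure_univ])
  rw [Measure.lintegral_compProd (by fun_prop), Measure.lintegral_compProd (by fun_prop)] at h
  simp only [lintegral_const, measure_univ, mul_one, ofReal_slope_mul_norm hs] at h
  rw [lintegral_sourcePotential hlam hs] at h
  refine h.trans_eq ?_
  congr 1
  rw [expectedDistortion, ← lintegral_const_mul' _ _ ENNReal.ofReal_ne_top]
  refine lintegral_congr fun w => ?_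
  rw [lintegral_const_mul' _ _ ENNReal.ofReal_ne_top]

/-- The supporting line of slope `s` bounds the rate and the distortion of every block code. -/
lemma ofReal_meanPotential_le_blockCode (hlam : ∀ i, 0 < lam i) {s : ℝ} (hs : 0 < s) {R : ℝ}
    {n M : ℕ} (hn : 0 < n) {e : (Fin n → EuclideanSpace ℝ (Fin q)) → Fin M}
    (he : Measurable e) (g : Fin M → Fin n → EuclideanSpace ℝ (Fin q))
    (hM : (M : ℝ) ≤ (2 : ℝ) ^ ((n : ℝ) * R)) :
    ENNReal.ofReal (meanPotential lam s) ≤ ENNReal.ofReal (R * Real.log 2) +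
      ENNReal.ofReal (s * √(q : ℝ)) * ∫⁻ x, blockDistortion x (g (e x))
        ∂(Measure.pi fun _ : Fin n => parallelLaplaceLaw lam) := by
  have := isProbabilityMeasure_parallelLaplaceLaw hlam
  set P := parallelLaplaceLaw lam
  have hn' : (n : ℝ≥0∞) ≠ 0 := by exact_mod_cast hn.ne'
  have hpos : ∀ (m : Fin M) (x : Fin n → EuclideanSpace ℝ (Fin q)),
      ∀ k, 0 ≤ s * √(q : ℝ) * ‖x k - g m k‖ := fun m x k => by positivity
  have h := lintegral_le_log_add_lintegral_code (Measure.pi fun _ : Fin n => P) he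
    (a := fun x => ∑ k, sourcePotential lam s (x k))
    (b := fun m x => ∑ k, s * √(q : ℝ) * ‖x k - g m k‖)
    (by fun_prop) (fun m => by fun_prop)
    (fun x => Finset.sum_nonneg fun k _ => sourcePotential_nonneg hlam hs (x k))
    (fun m x => Finset.sum_nonneg fun k _ => hpos m x k) (fun m => by
      simp only [← Finset.sum_sub_distrib, Real.exp_sum]
      simp only [ENNReal.ofReal_prod_of_nonneg fun i _ => (Real.exp_pos _).le]
      rw [lintegral_pi_prod (fun _ : Fin n => P) (f := fun k w => ENNReal.ofReal (Real.exp
        (sourcePotential lam s w - s * √(q : ℝ) * ‖w - g m k‖))) fun k => by fun_prop]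
      exact Finset.prod_le_one' fun k _ =>
        lintegral_exp_parallelLaplaceLaw_le_one hlam hs (g m k))
  have hmean : ∫⁻ x, ENNReal.ofReal (∑ k, sourcePotential lam s (x k))
      ∂(Measure.pi fun _ : Fin n => P) = n * ENNReal.ofReal (meanPotential lam s) := by
    simp only [ENNReal.ofReal_sum_of_nonneg fun k _ => sourcePotential_nonneg hlam hs _]
    rw [lintegral_finsetSum _ (by fun_prop)]
    simp only [fun k => (measurePreserving_eval (fun _ : Fin n => P) k).lintegral_comp
      (f := fun y => ENNReal.ofReal (sourcePotential lam s y)) (by fun_prop)]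
    simp [P, lintegral_sourcePotential hlam hs]
  have hdist : ∀ x : Fin n → EuclideanSpace ℝ (Fin q),
      ENNReal.ofReal (∑ k, s * √(q : ℝ) * ‖x k - g (e x) k‖) =
      (n * ENNReal.ofReal (s * √(q : ℝ))) * blockDistortion x (g (e x)) := fun x => by
    rw [ENNReal.ofReal_sum_of_nonneg fun k _ => hpos (e x) x k]
    simp only [ofReal_slope_mul_norm hs]
    rw [← Finset.mul_sum, mul_comm (n : ℝ≥0∞), mul_assoc, blockDistortion,
      ENNReal.mul_div_cancel hn' (ENNReal.natCast_ne_top n)]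
  have hlogM : ENNReal.ofReal (Real.log M) ≤ n * ENNReal.ofReal (R * Real.log 2) := by
    rw [← ENNReal.ofReal_natCast, ← ENNReal.ofReal_mul (Nat.cast_nonneg n)]
    refine ENNReal.ofReal_le_ofReal ?_
    have hM0 : 0 < M := (e 0).pos
    calc Real.log M ≤ Real.log ((2 : ℝ) ^ ((n : ℝ) * R)) :=
          Real.log_le_log (by exact_mod_cast hM0) hM
      _ = n * (R * Real.log 2) := by rw [Real.log_rpow two_pos, mul_assoc]
  simp only [hdist] at h
  rw [hmean, lintegral_const_mul' _ _
    (ENNReal.mul_ne_top (ENNReal.natCast_ne_top n) ENNReal.ofReal_ne_top), mul_assoc] at h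
  refine (ENNReal.mul_le_mul_iff_right hn' (ENNReal.natCast_ne_top n)).1 ?_
  rw [mul_add]
  exact h.trans (by gcongr)

lemma ofReal_meanPotential_le_of_isAchievable (hlam : ∀ i, 0 < lam i) {s : ℝ} (hs : 0 < s)
    {R D : ℝ≥0} (h : IsAchievable (parallelLaplaceLaw lam) R D) :
    ENNReal.ofReal (meanPotential lam s) ≤
      R * ENNReal.ofReal (Real.log 2) + ENNReal.ofReal (s * √(q : ℝ)) * D := by
  obtain ⟨M, e, g, he, hM, hlim⟩ := h
  set d : ℕ → ℝ≥0∞ := fun n => ∫⁻ x, blockDistortion x (g n (e n x))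
    ∂(Measure.pi fun _ : Fin n => parallelLaplaceLaw lam)
  set k := ENNReal.ofReal (s * √(q : ℝ))
  set r := (R : ℝ≥0∞) * ENNReal.ofReal (Real.log 2)
  have hn : ∀ n, 0 < n → (ENNReal.ofReal (meanPotential lam s) - r) / k ≤ d n := fun n hn => by
    refine ENNReal.div_le_of_le_mul' (tsub_le_iff_left.2 ?_)
    have h := ofReal_meanPotential_le_blockCode hlam hs hn (he n) (g n) (hM n)
    rwa [ENNReal.ofReal_mul R.coe_nonneg, ENNReal.ofReal_coe_nnreal] at h
  have hle : (ENNReal.ofReal (meanPotential lam s) - r) / k ≤ D := by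
    rw [ENNReal.ofReal_coe_nnreal] at hlim
    refine le_trans ?_ hlim
    exact le_limsup_of_frequently_le
      ((eventually_gt_atTop 0).mono fun n h => hn n h).frequently
  rcases Nat.eq_zero_or_pos q with rfl | hq
  · simp [meanPotential]
  have hk : k ≠ 0 := by
    simp only [k, ne_eq, ENNReal.ofReal_eq_zero, not_le]
    positivity
  rw [ENNReal.div_le_iff_le_mul (Or.inl hk) (Or.inl ENNReal.ofReal_ne_top), mul_comm] at hle
  exact tsub_le_iff_left.1 hle

end Certificate

/-! ### Water levels -/

section WaterLevel

variable {q : ℕ} {lam : Fin q → ℝ}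

lemma isWaterLevelForDistortion_iff {D μ : ℝ} :
    IsWaterLevelForDistortion lam D μ ↔
      ∑ i, min (μ / √(q : ℝ)) (1 / (lam i * √(q : ℝ))) = D := by
  rw [IsWaterLevelForDistortion, Finset.sum_filter, Finset.sum_filter, ← Finset.sum_add_distrib]
  have h : ∀ i, (if μ < 1 / lam i then μ / √(q : ℝ) else 0) +
      (if 1 / lam i ≤ μ then 1 / (lam i * √(q : ℝ)) else 0) =
      min (μ / √(q : ℝ)) (1 / (lam i * √(q : ℝ))) := fun i => by
    rw [← div_div, min_div_div_right (Real.sqrt_nonneg _)]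
    rcases lt_or_ge μ (1 / lam i) with h | h
    · rw [if_pos h, if_neg h.not_ge, min_eq_left h.le, add_zero]
    · rw [if_neg h.not_gt, if_pos h, min_eq_right h, zero_add]
  simp only [h]

lemma isWaterLevelForRate_iff (hlam : ∀ i, 0 < lam i) {R μ : ℝ} (hμ : 0 < μ) :
    IsWaterLevelForRate lam R μ ↔ ∑ i, max (-Real.logb 2 (lam i * μ)) 0 = R := by
  rw [IsWaterLevelForRate, Finset.sum_filter]
  have h : ∀ i, (if μ < 1 / lam i then -Real.logb 2 (lam i * μ) else 0) =
      max (-Real.logb 2 (lam i * μ)) 0 := fun i => by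
    have hi := hlam i
    rcases lt_or_ge μ (1 / lam i) with h | h
    · rw [if_pos h, max_eq_left]
      rw [lt_div_iff₀' hi] at h
      linarith [Real.logb_neg one_lt_two (mul_pos hi hμ) h]
    · rw [if_neg h.not_gt, max_eq_right]
      rw [div_le_iff₀' hi] at h
      linarith [Real.logb_nonneg one_lt_two h]
  simp only [h]

lemma exists_isWaterLevelForDistortion (hlam : ∀ i, 0 < lam i) {D : ℝ} (hD0 : 0 ≤ D)
    (hD : D ≤ ∑ i, 1 / (lam i * √(q : ℝ))) :
    ∃ μ : ℝ, 0 ≤ μ ∧ IsWaterLevelForDistortion lam D μ := by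
  simp only [isWaterLevelForDistortion_iff]
  have hm : 0 ≤ ∑ i, 1 / lam i := Finset.sum_nonneg fun i _ => (one_div_pos.2 (hlam i)).le
  have hcont : Continuous fun μ : ℝ => ∑ i, min (μ / √(q : ℝ)) (1 / (lam i * √(q : ℝ))) := by
    fun_prop
  have h0 : ∑ i, min ((0 : ℝ) / √(q : ℝ)) (1 / (lam i * √(q : ℝ))) = 0 :=
    Finset.sum_eq_zero fun i _ => by
      have := hlam i
      rw [zero_div, min_eq_left (by positivity)]
  have h1 : ∑ i, min ((∑ j, 1 / lam j) / √(q : ℝ)) (1 / (lam i * √(q : ℝ))) =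
      ∑ i, 1 / (lam i * √(q : ℝ)) :=
    Finset.sum_congr rfl fun i _ => by
      rw [← div_div, min_eq_right]
      gcongr
      exact Finset.single_le_sum (f := fun j => 1 / lam j)
        (fun j _ => (one_div_pos.2 (hlam j)).le) (Finset.mem_univ i)
  obtain ⟨μ, hμ, hμD⟩ := intermediate_value_Icc hm hcont.continuousOn
    (by rw [h0, h1]; exact ⟨hD0, hD⟩)
  exact ⟨μ, hμ.1, hμD⟩

lemma exists_isWaterLevelForRate (hq : 0 < q) (hlam : ∀ i, 0 < lam i) {R : ℝ} (hR : 0 ≤ R) :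
    ∃ μ : ℝ, 0 < μ ∧ IsWaterLevelForRate lam R μ := by
  -- In the variable `t = -log₂ μ` each summand is the positive part of `t - log₂ (lam i)`.
  have hlog : ∀ (i : Fin q) (t : ℝ),
      -Real.logb 2 (lam i * (2 : ℝ) ^ (-t)) = t - Real.logb 2 (lam i) := fun i t => by
    rw [Real.logb_mul (hlam i).ne' (by positivity), Real.logb_rpow two_pos (by norm_num)]
    ring
  let F : ℝ → ℝ := fun t => ∑ i, max (t - Real.logb 2 (lam i)) 0
  have hcont : Continuous F := by fun_prop
  let S : ℝ := ∑ i, |Real.logb 2 (lam i)|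
  have hS : ∀ i, |Real.logb 2 (lam i)| ≤ S := fun i =>
    Finset.single_le_sum (f := fun i => |Real.logb 2 (lam i)|) (fun _ _ => abs_nonneg _)
      (Finset.mem_univ i)
  have hS0 : 0 ≤ S := Finset.sum_nonneg fun _ _ => abs_nonneg _
  have h0 : F (-S) = 0 := Finset.sum_eq_zero fun i _ =>
    max_eq_right (by linarith [neg_abs_le (Real.logb 2 (lam i)), hS i])
  have h1 : R ≤ F (S + R) := by
    refine le_trans ?_ (Finset.single_le_sum
      (f := fun i => max (S + R - Real.logb 2 (lam i)) 0) (fun _ _ => le_max_right _ _)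
      (Finset.mem_univ ⟨0, hq⟩))
    exact le_max_of_le_left (by linarith [le_abs_self (Real.logb 2 (lam ⟨0, hq⟩)), hS ⟨0, hq⟩])
  obtain ⟨t, -, ht⟩ := intermediate_value_Icc (show -S ≤ S + R by linarith) hcont.continuousOn
    (show R ∈ Set.Icc (F (-S)) (F (S + R)) from ⟨h0.trans_le hR, h1⟩)
  refine ⟨(2 : ℝ) ^ (-t), by positivity, (isWaterLevelForRate_iff hlam (by positivity)).2 ?_⟩
  simpa only [hlog] using ht

/-! ### From supporting lines to the water-filling bounds -/

/-- At the slope `1 / μ` the supporting line touches the water-filling curve. -/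
lemma meanPotential_one_div (hlam : ∀ i, 0 < lam i) {μ : ℝ} (hμ : 0 < μ) :
    meanPotential lam (1 / μ) = (∑ i, max (-Real.logb 2 (lam i * μ)) 0) * Real.log 2 +
      1 / μ * √(q : ℝ) * ∑ i, min (μ / √(q : ℝ)) (1 / (lam i * √(q : ℝ))) := by
  rw [meanPotential, Finset.sum_mul, Finset.mul_sum, ← Finset.sum_add_distrib]
  refine Finset.sum_congr rfl fun i _ => ?_
  have hi := hlam i
  have hq : 0 < √(q : ℝ) := Real.sqrt_pos.2 (by exact_mod_cast i.pos)
  have hlog2 : 0 < Real.log 2 := Real.log_pos one_lt_two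
  congr 1
  · rw [max_mul_of_nonneg _ _ hlog2.le, zero_mul, neg_mul, Real.logb,
      div_mul_cancel₀ _ hlog2.ne', ← Real.log_inv]
    congr 2
    field_simp
  · have h : 1 / μ * √(q : ℝ) * (min μ (1 / lam i) / √(q : ℝ)) = 1 / μ * min μ (1 / lam i) := by
      field_simp
    rw [← div_div, min_div_div_right hq.le, h, min_mul_of_nonneg _ _ (one_div_pos.2 hi).le,
      mul_min_of_nonneg _ _ (one_div_pos.2 hμ).le, mul_one_div_cancel hi.ne',
      one_div_mul_cancel hμ.ne']

lemma sum_negLogPos {μ : ℝ} (hlam : ∀ i, 0 < lam i) (hμ : 0 < μ) :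
    ∑ i, negLogPos (lam i * μ) =
      ENNReal.ofReal (∑ i, max (-Real.logb 2 (lam i * μ)) 0) := by
  rw [ENNReal.ofReal_sum_of_nonneg fun _ _ => le_max_right _ _]
  refine Finset.sum_congr rfl fun i _ => ?_
  rw [negLogPos, if_neg (mul_pos (hlam i) hμ).not_ge]

lemma real_supportingLine {R D : ℝ≥0∞} {r d m : ℝ} {k : ℝ} (hr : 0 ≤ r) (hd : 0 ≤ d)
    (hk : 0 ≤ k) (hR : R ≤ ENNReal.ofReal r) (hD : D ≤ ENNReal.ofReal d)
    (h : ENNReal.ofReal m ≤ R * ENNReal.ofReal (Real.log 2) + ENNReal.ofReal k * D) :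
    m ≤ r * Real.log 2 + k * d := by
  have hlog2 : 0 < Real.log 2 := Real.log_pos one_lt_two
  refine (ENNReal.ofReal_le_ofReal_iff (by positivity)).1 (h.trans ?_)
  rw [ENNReal.ofReal_add (by positivity) (by positivity), ENNReal.ofReal_mul hr,
    ENNReal.ofReal_mul hk]
  gcongr

lemma sum_negLogPos_le_of_supportingLines (hq : 0 < q) (hlam : ∀ i, 0 < lam i) {R D : ℝ≥0∞}
    (h : ∀ s : ℝ, 0 < s → ENNReal.ofReal (meanPotential lam s) ≤
      R * ENNReal.ofReal (Real.log 2) + ENNReal.ofReal (s * √(q : ℝ)) * D)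
    {d μ : ℝ} (hd : 0 ≤ d) (hDd : D ≤ ENNReal.ofReal d) (hμ : 0 ≤ μ)
    (hlevel : IsWaterLevelForDistortion lam d μ) :
    ∑ i, negLogPos (lam i * μ) ≤ R := by
  have hlog2 : 0 < Real.log 2 := Real.log_pos one_lt_two
  rcases eq_or_ne R ⊤ with rfl | hR
  · exact le_top
  lift R to ℝ≥0 using hR
  have hline : ∀ s : ℝ, 0 < s → meanPotential lam s ≤ R * Real.log 2 + s * √(q : ℝ) * d :=
    fun s hs => real_supportingLine R.2 hd (by positivity) (ENNReal.ofReal_coe_nnreal).ge hDd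
      (h s hs)
  rw [isWaterLevelForDistortion_iff] at hlevel
  rcases hμ.eq_or_lt with rfl | hμ
  · -- The level `0` forces `d = 0`; the supporting lines of arbitrarily large slope then
    -- exclude every finite rate.
    exfalso
    have hd0 : d = 0 := by
      rw [← hlevel]
      refine Finset.sum_eq_zero fun i _ => ?_
      have := hlam i
      rw [zero_div, min_eq_left (by positivity)]
    obtain ⟨ν, hν, hνR⟩ := exists_isWaterLevelForRate hq hlam
      (show (0 : ℝ) ≤ R + 1 by positivity)
    rw [isWaterLevelForRate_iff hlam hν] at hνR
    have h1 := hline (1 / ν) (by positivity)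
    rw [meanPotential_one_div hlam hν, hνR, hd0, mul_zero, add_zero] at h1
    have h2 : 0 ≤ 1 / ν * √(q : ℝ) * ∑ i, min (ν / √(q : ℝ)) (1 / (lam i * √(q : ℝ))) := by
      refine mul_nonneg (by positivity) (Finset.sum_nonneg fun i _ => ?_)
      have := hlam i
      exact le_min (by positivity) (by positivity)
    linarith
  · have h1 := hline (1 / μ) (by positivity)
    rw [meanPotential_one_div hlam hμ, hlevel] at h1
    rw [sum_negLogPos hlam hμ]
    refine ENNReal.ofReal_le_of_le_toReal ?_
    rw [ENNReal.coe_toReal]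
    exact le_of_mul_le_mul_right (by linarith) hlog2

lemma sum_min_le_of_supportingLines (hq : 0 < q) (hlam : ∀ i, 0 < lam i) {R D : ℝ≥0∞}
    (h : ∀ s : ℝ, 0 < s → ENNReal.ofReal (meanPotential lam s) ≤
      R * ENNReal.ofReal (Real.log 2) + ENNReal.ofReal (s * √(q : ℝ)) * D)
    {r μ : ℝ} (hr : 0 ≤ r) (hRr : R ≤ ENNReal.ofReal r) (hμ : 0 < μ)
    (hlevel : IsWaterLevelForRate lam r μ) :
    ENNReal.ofReal (∑ i, min (μ / √(q : ℝ)) (1 / (lam i * √(q : ℝ)))) ≤ D := by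
  rcases eq_or_ne D ⊤ with rfl | hD
  · exact le_top
  lift D to ℝ≥0 using hD
  have hk : 0 < 1 / μ * √(q : ℝ) := by positivity
  have h1 := real_supportingLine hr D.2 hk.le hRr (ENNReal.ofReal_coe_nnreal).ge
    (h (1 / μ) (by positivity))
  rw [isWaterLevelForRate_iff hlam hμ] at hlevel
  rw [meanPotential_one_div hlam hμ, hlevel] at h1
  refine ENNReal.ofReal_le_of_le_toReal ?_
  rw [ENNReal.coe_toReal]
  exact le_of_mul_le_mul_left (le_of_add_le_add_left h1) hk

end WaterLevel

theorem proposition3 (q : ℕ) (hq : 0 < q) (lam : Fin q → ℝ) (hlam : ∀ i, 0 < lam i) :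
    -- the level for a distortion exists
    (∀ D : ℝ, 0 ≤ D → D ≤ ∑ i, 1 / (lam i * √(q : ℝ)) →
      ∃ μ : ℝ, 0 ≤ μ ∧ IsWaterLevelForDistortion lam D μ) ∧
    -- lower bound on the rate-distortion function
    (∀ D μ : ℝ, 0 ≤ D → 0 ≤ μ → IsWaterLevelForDistortion lam D μ →
      ∑ i, negLogPos (lam i * μ) ≤ rateDistortion (parallelLaplaceLaw lam) D ∧
      ∑ i, negLogPos (lam i * μ) ≤ operationalRateDistortion (parallelLaplaceLaw lam) D) ∧
    -- the level for a rate exists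
    (∀ R : ℝ, 0 ≤ R → ∃ μ : ℝ, 0 < μ ∧ IsWaterLevelForRate lam R μ) ∧
    -- lower bound on the distortion-rate function
    (∀ R μ : ℝ, 0 ≤ R → 0 < μ → IsWaterLevelForRate lam R μ →
      ENNReal.ofReal (∑ i, min (μ / √(q : ℝ)) (1 / (lam i * √(q : ℝ)))) ≤
        distortionRate (parallelLaplaceLaw lam) R ∧
      ENNReal.ofReal (∑ i, min (μ / √(q : ℝ)) (1 / (lam i * √(q : ℝ)))) ≤
        operationalDistortionRate (parallelLaplaceLaw lam) R) := by
  refine ⟨fun D hD0 hD => exists_isWaterLevelForDistortion hlam hD0 hD,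
    fun D μ hD hμ hlevel => ⟨?_, ?_⟩, fun R hR => exists_isWaterLevelForRate hq hlam hR,
    fun R μ hR hμ hlevel => ⟨?_, ?_⟩⟩
  · refine le_iInf fun κ => le_iInf fun _ => le_iInf fun hκ => ?_
    exact sum_negLogPos_le_of_supportingLines hq hlam
      (fun s hs => ofReal_meanPotential_le_mutualInfoBits hlam hs κ) hD hκ hμ hlevel
  · refine le_iInf fun R => le_iInf fun hR => ?_
    lift D to ℝ≥0 using hD
    exact sum_negLogPos_le_of_supportingLines hq hlam
      (fun s hs => ofReal_meanPotential_le_of_isAchievable hlam hs hR) D.2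
      (ENNReal.ofReal_coe_nnreal).ge hμ hlevel
  · refine le_iInf fun κ => le_iInf fun _ => le_iInf fun hκ => ?_
    exact sum_min_le_of_supportingLines hq hlam
      (fun s hs => ofReal_meanPotential_le_mutualInfoBits hlam hs κ) hR hκ hμ hlevel
  · refine le_iInf fun D => le_iInf fun hD => ?_
    lift R to ℝ≥0 using hR
    exact sum_min_le_of_supportingLines hq hlam
      (fun s hs => ofReal_meanPotential_le_of_isAchievable hlam hs hD) R.2
      (ENNReal.ofReal_coe_nnreal).ge hμ hlevel

end
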